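/- Let $\mathbb F$ be a finite field of order $q$, let $\beta>0$ be a real number and let $t\ge 1$ be an integer. An $\mathbb F$-represented matroid is a pair $M=(E,U)$, where $E$ is a finite set and $U$ is a subspace of $\mathbb F^E$; we write $|M|=|E|$, and for $X\subseteq E$ we let $r_M(X)$ be the dimension of the space $\{u|_X : u\in U\}$, with $r(M)=r_M(E)$. Suppose that $U$ is the row space of a matrix $A$ over $\mathbb F$ with finite row set $V$ and column set $E$ in which every column has at most two nonzero entries (so $M$ is an $\mathbb F$-represented frame matroid). Let $(G,\Sigma)$ be a graph representation of $A$, that is, a directed graph $G$ (loops and parallel arcs allowed) with vertex set $V$ and arc set $E$, together with labels $\Sigma:E\to\mathbb F^\times$, such that for each $e\in E$: - if column $e$ of $A$ has two nonzero entries, then, for a suitable naming $x,y$ of their rows, $e$ is an arc from $x$ to $y$ with label $\Sigma(e)=-A_{x,e}A_{y,e}^{-1}$; - if column $e$ has exactly one nonzero entry, in row $x$, then $e$ is a loop at $x$ with $\Sigma(e)\ne 1$; - if column $e$ is zero, then $e$ is a loop with $\Sigma(e)=1$. Suppose that $G$ is connected, meaning that any two vertices are joined by a path of the underlying undirected graph.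 If \[ r(M)\ \ge\ \max\left(q,\ (2q-3)\beta^{-1}+1-q,\ \frac{1}{q-1}\left(\frac{4t}{\beta\log(1+\beta)}\right)^2,\ \frac{1+\beta}{q-1}\,e^4\right) \] and $|M|\ge(1+q\beta)\,r(M)$, then there is a set $X\subseteq E$ such that \[ r_M(X)\le |X|-t\qquad\text{and}\qquad |X|\le\frac{4t\log r(M)}{\log(1+\beta)}. \] -/

import Mathlib

/-- An `F`-represented matroid on the ground set `E`: a subspace of `F ^ E`. -/
structure RepMatroid (F E : Type*) [Field F] where
  space : Submodule F (E → F)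

namespace RepMatroid

/-- `r_M(X)`: the dimension of the space of restrictions `u|X` of the vectors `u` of `M`. -/
noncomputable def rank {F E : Type*} [Field F] (M : RepMatroid F E) (X : Set E) : ℕ :=
  Module.finrank F (M.space.map (LinearMap.funLeft F F (Subtype.val : X → E)))

/-- The represented matroid `M(A)` generated by the matrix `A`: its space is the row space. -/
def ofMatrix {F V E : Type*} [Field F] (A : Matrix V E F) : RepMatroid F E where
  space := Submodule.span F (Set.range A.row)

end RepMatroid

/-- A `Γ`-labelled digraph with vertex set `V` and arc set `E` (loops and parallel arcs allowed). -/
structure LabelledDigraph (Γ V E : Type*) where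
  tail : E → V
  head : E → V
  label : E → Γ

namespace LabelledDigraph

/-- Connectedness: any two vertices are joined by a path of the underlying undirected graph. -/
def IsConnected {Γ V E : Type*} (G : LabelledDigraph Γ V E) : Prop :=
  (SimpleGraph.fromRel (fun x y : V => ∃ e : E, G.tail e = x ∧ G.head e = y)).Preconnected

end LabelledDigraph

/-- A frame matrix: every column has at most two nonzero entries. -/
def IsFrameMatrix {F V E : Type*} [Field F] (A : Matrix V E F) : Prop :=
  ∀ e : E, {x : V | A x e ≠ 0}.encard ≤ 2

/-- `G` is a graph representation of the frame matrix `A`. -/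
structure IsGraphRepresentation {F V E : Type*} [Field F]
    (G : LabelledDigraph Fˣ V E) (A : Matrix V E F) : Prop where
  two : ∀ (e : E) (x y : V), x ≠ y → A x e ≠ 0 → A y e ≠ 0 →
    (G.tail e = x ∧ G.head e = y ∧ (G.label e : F) = -(A x e) * (A y e)⁻¹) ∨
    (G.tail e = y ∧ G.head e = x ∧ (G.label e : F) = -(A y e) * (A x e)⁻¹)
  one : ∀ (e : E) (x : V), A x e ≠ 0 → (∀ y : V, y ≠ x → A y e = 0) →
    G.tail e = x ∧ G.head e = x ∧ G.label e ≠ 1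
  zero : ∀ e : E, (∀ x : V, A x e = 0) → G.tail e = G.head e ∧ G.label e = 1

/-- `G` is a graph representation of the represented frame matroid `M`: it is a graph
representation of some frame matrix generating `M`. (So `M` is a frame matroid.) -/
def IsGraphRepresentationOf {F V E : Type*} [Field F]
    (G : LabelledDigraph Fˣ V E) (M : RepMatroid F E) : Prop :=
  ∃ A : Matrix V E F, IsFrameMatrix A ∧ RepMatroid.ofMatrix A = M ∧ IsGraphRepresentation G A

/-! The proof is a Moore-bound argument in the covering graph with vertex set `V × Fˣ` and edge set
`E × Fˣ`: the edge over `(e, γ)` joins `(tail e, σ e * γ)` to `(head e, γ)`. Placing the vector `γ •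
1_x` at `(x, γ)` makes the difference along each edge a nonzero multiple of a column of the matrix,
so a closed walk gives a linear relation between columns.

Suppose that all sets of at most `L` columns are independent. If a ball of radius `k` met more edges
than the next ball has vertices, two edges outside a breadth-first tree would each close a
"lollipop" (a cycle with a stem to the root). In the relation from a short cycle every column occurs
at least twice, so a lollipop projects to at most `k + 1` columns, and both together to an
independent set of at most `L`. But edges over an independent set never outnumber the vertices they
span, whereas two lollipops with a common root have more edges than vertices
(`card_incident_ball_le`).

In a core of density `D` the balls thus grow by a factor `D`, whence `2 * D ^ R ≤ |V| (q - 1)`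
(`two_mul_pow_le_card`). Connectedness gives `|V| ≤ r + 1`, so the density hypothesis violates this
bound, even after deletion of fewer than `t` elements. The small dependent sets so obtained are
merged into one set of nullity at least `t` (`exists_large_nullity`). -/

namespace Multigraph

/-! ### Balls in multigraphs. -/

variable {ω ε : Type*}

open Classical in
/-- The edges of `H` having an end in `S`. -/
noncomputable def incident (src tgt : ε → ω) (H : Finset ε) (S : Finset ω) : Finset ε :=
  H.filter fun g => src g ∈ S ∨ tgt g ∈ S

open Classical in
/-- The ball of radius `k` around `w₀` in the multigraph with edge set `H`. -/
noncomputable def ball (src tgt : ε → ω) (H : Finset ε) (w₀ : ω) : ℕ → Finset ω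
  | 0 => {w₀}
  | k + 1 => ball src tgt H w₀ k ∪
      ((incident src tgt H (ball src tgt H w₀ k)).image src ∪
        (incident src tgt H (ball src tgt H w₀ k)).image tgt)

theorem mem_incident {src tgt : ε → ω} {H : Finset ε} {S : Finset ω} {g : ε} :
    g ∈ incident src tgt H S ↔ g ∈ H ∧ (src g ∈ S ∨ tgt g ∈ S) := by
  simp [incident]

theorem mem_ball_zero {src tgt : ε → ω} {H : Finset ε} {w₀ w : ω} :
    w ∈ ball src tgt H w₀ 0 ↔ w = w₀ := by
  simp [ball]

theorem mem_ball_succ {src tgt : ε → ω} {H : Finset ε} {w₀ w : ω} {k : ℕ} :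
    w ∈ ball src tgt H w₀ (k + 1) ↔ w ∈ ball src tgt H w₀ k ∨
      ∃ g ∈ incident src tgt H (ball src tgt H w₀ k), src g = w ∨ tgt g = w := by
  classical
  simp only [ball, Finset.mem_union, Finset.mem_image]
  constructor
  · rintro (h | ⟨g, hg, h⟩ | ⟨g, hg, h⟩)
    · exact Or.inl h
    · exact Or.inr ⟨g, hg, Or.inl h⟩
    · exact Or.inr ⟨g, hg, Or.inr h⟩
  · rintro (h | ⟨g, hg, h | h⟩)
    · exact Or.inl h
    · exact Or.inr (Or.inl ⟨g, hg, h⟩)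
    · exact Or.inr (Or.inr ⟨g, hg, h⟩)

theorem ball_mono (src tgt : ε → ω) (H : Finset ε) (w₀ : ω) :
    Monotone (ball src tgt H w₀) :=
  monotone_nat_of_le_succ fun _ _ hw => mem_ball_succ.2 (Or.inl hw)

theorem root_mem_ball (src tgt : ε → ω) (H : Finset ε) (w₀ : ω) (k : ℕ) :
    w₀ ∈ ball src tgt H w₀ k :=
  ball_mono src tgt H w₀ (Nat.zero_le k) (mem_ball_zero.2 rfl)

theorem ball_subset {src tgt : ε → ω} {H : Finset ε} {w₀ : ω} {K : Finset ω} (h₀ : w₀ ∈ K)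
    (hH : ∀ g ∈ H, src g ∈ K ∧ tgt g ∈ K) (k : ℕ) : ball src tgt H w₀ k ⊆ K := by
  induction k with
  | zero => intro w hw; rw [mem_ball_zero.1 hw]; exact h₀
  | succ k ih =>
    intro w hw
    rcases mem_ball_succ.1 hw with h | ⟨g, hg, rfl | rfl⟩
    · exact ih h
    · exact (hH g (mem_incident.1 hg).1).1
    · exact (hH g (mem_incident.1 hg).1).2

theorem ends_mem_ball_succ {src tgt : ε → ω} {H : Finset ε} {w₀ : ω} {k : ℕ} {g : ε}
    (hg : g ∈ incident src tgt H (ball src tgt H w₀ k)) :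
    src g ∈ ball src tgt H w₀ (k + 1) ∧ tgt g ∈ ball src tgt H w₀ (k + 1) :=
  ⟨mem_ball_succ.2 (Or.inr ⟨g, hg, Or.inl rfl⟩), mem_ball_succ.2 (Or.inr ⟨g, hg, Or.inr rfl⟩)⟩

/-! ### Dense cores, degrees and breadth-first trees. -/

/-- A dense multigraph has a nonempty set of vertices inside which every set of vertices meets
many edges. -/
theorem exists_dense_core [Fintype ω] [Nonempty ω] [Fintype ε] (src tgt : ε → ω) (D : ℝ)
    (h : D * Fintype.card ω ≤ Fintype.card ε) :
    ∃ (K : Finset ω) (H : Finset ε), K.Nonempty ∧ (∀ g ∈ H, src g ∈ K ∧ tgt g ∈ K) ∧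
      D * K.card ≤ H.card ∧ ∀ S ⊆ K, D * S.card ≤ (incident src tgt H S).card := by
  classical
  let I : Finset ω → Finset ε := fun K => Finset.univ.filter fun g => src g ∈ K ∧ tgt g ∈ K
  let P : Finset (Finset ω) :=
    Finset.univ.filter fun K => K.Nonempty ∧ D * K.card ≤ (I K).card
  have hP : P.Nonempty := by
    refine ⟨Finset.univ, ?_⟩
    simp only [P, I, Finset.mem_filter, Finset.mem_univ, true_and, and_self, Finset.filter_true]
    exact ⟨Finset.univ_nonempty, by simpa using h⟩
  -- Take `K` of minimum size: if a proper nonempty `S` met fewer than `D * |S|` edges, `K \ S`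
  -- would still have density `D`.
  obtain ⟨K, hK, hmin⟩ := Finset.exists_min_image P Finset.card hP
  simp only [P, Finset.mem_filter, Finset.mem_univ, true_and] at hK hmin
  refine ⟨K, I K, hK.1, fun g hg => by simpa [I] using hg, hK.2, fun S hS => ?_⟩
  by_contra! hlt
  have hSne : S.Nonempty := by
    rw [Finset.nonempty_iff_ne_empty]
    rintro rfl
    simp only [Finset.card_empty, Nat.cast_zero, mul_zero] at hlt
    exact absurd hlt (not_lt.2 (Nat.cast_nonneg _))
  by_cases hSK : S = K
  · subst hSK
    have : incident src tgt (I S) S = I S := by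
      ext g
      simp only [mem_incident, I, Finset.mem_filter, Finset.mem_univ, true_and]
      tauto
    rw [this] at hlt
    linarith [hK.2]
  · have hsub : (K \ S).Nonempty := by
      rw [Finset.sdiff_nonempty]
      exact fun h => hSK (hS.antisymm h)
    have hI : I (K \ S) = I K \ incident src tgt (I K) S := by
      ext g
      simp only [mem_incident, I, Finset.mem_filter, Finset.mem_univ, true_and, Finset.mem_sdiff]
      tauto
    have hinc : incident src tgt (I K) S ⊆ I K := Finset.filter_subset _ _
    have h1 := Finset.card_sdiff_add_card_eq_card hinc
    have h2 := Finset.card_sdiff_add_card_eq_card hS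
    have h3 := hmin (K \ S) ⟨hsub, by
      rw [hI]
      have h1' : ((I K \ incident src tgt (I K) S).card : ℝ)
          + (incident src tgt (I K) S).card = (I K).card := by exact_mod_cast h1
      have h2' : ((K \ S).card : ℝ) + S.card = K.card := by exact_mod_cast h2
      have := hK.2
      rw [← h2'] at this
      nlinarith⟩
    have := hSne.card_pos
    omega

/-- In a loopless multigraph some vertex has at least the average degree. -/
theorem exists_large_degree {src tgt : ε → ω} {K : Finset ω} {H : Finset ε} {D : ℝ}
    (hK : K.Nonempty) (hH : ∀ g ∈ H, src g ∈ K ∧ tgt g ∈ K) (hD : D * K.card ≤ H.card)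
    (hloop : ∀ g ∈ H, src g ≠ tgt g) :
    ∃ w ∈ K, 2 * D ≤ (incident src tgt H {w}).card := by
  classical
  have hsum : ∑ w ∈ K, (incident src tgt H {w}).card = 2 * H.card := by
    have : ∀ w, (incident src tgt H {w}).card = ∑ g ∈ H, if src g = w ∨ tgt g = w then 1 else 0 := by
      intro w
      rw [incident, Finset.card_filter]
      simp
    simp_rw [this]
    rw [Finset.sum_comm, mul_comm, ← smul_eq_mul, ← Finset.sum_const]
    refine Finset.sum_congr rfl fun g hg => ?_
    rw [← Finset.card_filter]
    have : K.filter (fun w => src g = w ∨ tgt g = w) = {src g, tgt g} := by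
      ext w
      simp only [Finset.mem_filter, Finset.mem_insert, Finset.mem_singleton]
      constructor
      · rintro ⟨-, rfl | rfl⟩ <;> simp
      · rintro (rfl | rfl)
        · exact ⟨(hH g hg).1, Or.inl rfl⟩
        · exact ⟨(hH g hg).2, Or.inr rfl⟩
    rw [this, Finset.card_pair (hloop g hg)]
  apply Finset.exists_le_of_sum_le hK
  rw [Finset.sum_const, nsmul_eq_mul]
  have : ((∑ w ∈ K, (incident src tgt H {w}).card : ℕ) : ℝ) = 2 * H.card := by
    rw [hsum]; push_cast; ring
  push_cast at this
  linarith

/-- A breadth-first search tree. -/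
theorem exists_parent [Nonempty ε] (src tgt : ε → ω) (H : Finset ε) (w₀ : ω) :
    ∃ (par : ω → ω) (p : ω → ε) (lev : ω → ℕ),
      (∀ k, ∀ w ∈ ball src tgt H w₀ k, lev w ≤ k) ∧
      (par w₀ = w₀) ∧
      ∀ k, ∀ w ∈ ball src tgt H w₀ k, w ≠ w₀ →
        par w ∈ ball src tgt H w₀ k ∧ lev (par w) < lev w ∧
        ((src (p w) = par w ∧ tgt (p w) = w) ∨ (src (p w) = w ∧ tgt (p w) = par w)) := by
  classical
  -- The distance from the root; the value `0` at unreachable vertices plays no role, since every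
  -- claim assumes membership in a ball.
  let lev : ω → ℕ := fun w =>
    if h : ∃ k, w ∈ ball src tgt H w₀ k then Nat.find h else 0
  have hlev : ∀ k, ∀ w ∈ ball src tgt H w₀ k, lev w ≤ k := by
    intro k w hw
    have h : ∃ k, w ∈ ball src tgt H w₀ k := ⟨k, hw⟩
    simp only [lev, dif_pos h]
    exact Nat.find_min' h hw
  have hspec : ∀ k, ∀ w ∈ ball src tgt H w₀ k, w ∈ ball src tgt H w₀ (lev w) := by
    intro k w hw
    have h : ∃ k, w ∈ ball src tgt H w₀ k := ⟨k, hw⟩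
    simp only [lev, dif_pos h]
    exact Nat.find_spec h
  have key : ∀ w, ∃ (u : ω) (g : ε), (w = w₀ → u = w₀) ∧
      ∀ k, w ∈ ball src tgt H w₀ k → w ≠ w₀ →
        u ∈ ball src tgt H w₀ k ∧ lev u < lev w ∧
        ((src g = u ∧ tgt g = w) ∨ (src g = w ∧ tgt g = u)) := by
    intro w
    by_cases h : w ≠ w₀ ∧ ∃ k, w ∈ ball src tgt H w₀ k
    · obtain ⟨hne, k₀, hk₀⟩ := h
      have hw := hspec k₀ w hk₀
      obtain ⟨j, hj⟩ : ∃ j, lev w = j + 1 := by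
        refine Nat.exists_eq_succ_of_ne_zero fun h0 => hne ?_
        rw [h0] at hw
        exact mem_ball_zero.1 hw
      rw [hj] at hw
      have hnot : w ∉ ball src tgt H w₀ j := fun h => by
        have := hlev j w h
        omega
      rcases mem_ball_succ.1 hw with h | ⟨g, hg, h⟩
      · exact absurd h hnot
      · have aux : ∀ u ∈ ball src tgt H w₀ j, (∀ k, w ∈ ball src tgt H w₀ k →
            u ∈ ball src tgt H w₀ k ∧ lev u < lev w) := by
          intro u hu k hk
          have h1 := hlev _ _ hk
          have h2 := hlev _ _ hu
          exact ⟨ball_mono src tgt H w₀ (by omega) hu, by omega⟩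
        rcases h with h | h
        · have hu : tgt g ∈ ball src tgt H w₀ j := by
            rcases (mem_incident.1 hg).2 with h' | h'
            · rw [h] at h'; exact absurd h' hnot
            · exact h'
          exact ⟨tgt g, g, fun h => absurd h hne, fun k hk _ =>
            ⟨(aux _ hu k hk).1, (aux _ hu k hk).2, Or.inr ⟨h, rfl⟩⟩⟩
        · have hu : src g ∈ ball src tgt H w₀ j := by
            rcases (mem_incident.1 hg).2 with h' | h'
            · exact h'
            · rw [h] at h'; exact absurd h' hnot
          exact ⟨src g, g, fun h => absurd h hne, fun k hk _ =>
            ⟨(aux _ hu k hk).1, (aux _ hu k hk).2, Or.inl ⟨rfl, h⟩⟩⟩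
    · refine ⟨w₀, Classical.arbitrary ε, fun _ => rfl, fun k hk hne => absurd ⟨hne, k, hk⟩ h⟩
  choose par p hroot hpar using key
  exact ⟨par, p, lev, hlev, hroot w₀ rfl, fun k w hw hne => hpar w k hw hne⟩

/-! ### Paths to the root in a tree. -/

open Classical in
/-- The ancestors of `w`, including `w` itself and excluding the root, in the tree with parent
function `par`. -/
noncomputable def ancestors [Fintype ω] (par : ω → ω) (w₀ w : ω) : Finset ω :=
  Finset.univ.filter fun u => u ≠ w₀ ∧ ∃ i, par^[i] w = u

section Ancestors

variable [Fintype ω] {par : ω → ω} {w₀ : ω}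

theorem mem_ancestors {w u : ω} : u ∈ ancestors par w₀ w ↔ u ≠ w₀ ∧ ∃ i, par^[i] w = u := by
  simp [ancestors]

theorem ancestors_root (h : par w₀ = w₀) : ancestors par w₀ w₀ = ∅ := by
  ext u
  simp only [mem_ancestors, Finset.notMem_empty, iff_false, not_and, not_exists]
  intro hu i hi
  rw [Function.iterate_fixed h] at hi
  exact hu hi.symm

theorem self_mem_ancestors {w : ω} (h : w ≠ w₀) : w ∈ ancestors par w₀ w :=
  mem_ancestors.2 ⟨h, 0, rfl⟩

theorem parent_mem_ancestors {w u : ω} (h : u ∈ ancestors par w₀ w) (hne : par u ≠ w₀) :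
    par u ∈ ancestors par w₀ w := by
  obtain ⟨-, i, rfl⟩ := mem_ancestors.1 h
  exact mem_ancestors.2 ⟨hne, i + 1, Function.iterate_succ_apply' par i w⟩

open Classical in
theorem ancestors_eq_insert {w : ω} (h : w ≠ w₀) :
    ancestors par w₀ w = insert w (ancestors par w₀ (par w)) := by
  ext u
  rw [Finset.mem_insert, mem_ancestors, mem_ancestors]
  constructor
  · rintro ⟨hu, i, hi⟩
    cases i with
    | zero => exact Or.inl hi.symm
    | succ i => exact Or.inr ⟨hu, i, hi⟩
  · rintro (rfl | ⟨hu, i, hi⟩)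
    · exact ⟨h, 0, rfl⟩
    · exact ⟨hu, i + 1, hi⟩

variable {lev : ω → ℕ} {B : ℕ → Finset ω}

theorem ancestors_subset_and_lev (hroot : par w₀ = w₀)
    (hpar : ∀ k, ∀ w ∈ B k, w ≠ w₀ → par w ∈ B k ∧ lev (par w) < lev w) {k : ℕ} :
    ∀ (n : ℕ) (w : ω), lev w = n → w ∈ B k →
      ∀ u ∈ ancestors par w₀ w, u ∈ B k ∧ lev u ≤ lev w := by
  classical
  intro n
  induction n using Nat.strong_induction_on with
  | _ n ih =>
    intro w hn hw u hu
    by_cases hne : w = w₀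
    · subst hne
      rw [ancestors_root hroot] at hu
      simp at hu
    · rw [ancestors_eq_insert hne, Finset.mem_insert] at hu
      rcases hu with rfl | hu
      · exact ⟨hw, le_rfl⟩
      · obtain ⟨h1, h2⟩ := hpar k w hw hne
        obtain ⟨h3, h4⟩ := ih (lev (par w)) (hn ▸ h2) (par w) rfl h1 u hu
        exact ⟨h3, h4.trans h2.le⟩

theorem not_mem_ancestors_parent (hroot : par w₀ = w₀)
    (hpar : ∀ k, ∀ w ∈ B k, w ≠ w₀ → par w ∈ B k ∧ lev (par w) < lev w) {k : ℕ} {w : ω}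
    (hw : w ∈ B k) (hne : w ≠ w₀) : w ∉ ancestors par w₀ (par w) := by
  intro h
  obtain ⟨h1, h2⟩ := hpar k w hw hne
  have := (ancestors_subset_and_lev hroot hpar _ _ rfl h1 w h).2
  omega

theorem card_ancestors_le (hroot : par w₀ = w₀)
    (hpar : ∀ k, ∀ w ∈ B k, w ≠ w₀ → par w ∈ B k ∧ lev (par w) < lev w) {k : ℕ} :
    ∀ (n : ℕ) (w : ω), lev w = n → w ∈ B k → (ancestors par w₀ w).card ≤ n := by
  classical
  intro n
  induction n using Nat.strong_induction_on with
  | _ n ih =>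
    intro w hn hw
    by_cases hne : w = w₀
    · subst hne
      simp [ancestors_root hroot]
    · obtain ⟨h1, h2⟩ := hpar k w hw hne
      rw [ancestors_eq_insert hne]
      have := ih _ (hn ▸ h2) (par w) rfl h1
      have := Finset.card_insert_le w (ancestors par w₀ (par w))
      omega

/-- Each non-root vertex stands for the edge to its parent, so the sum telescopes along the path to
the root. Two such paths and one more edge yield the relation of a closed walk. -/
theorem sum_ancestors {M : Type*} [AddCommGroup M] (b : ω → M) (hroot : par w₀ = w₀)
    (hpar : ∀ k, ∀ w ∈ B k, w ≠ w₀ → par w ∈ B k ∧ lev (par w) < lev w) {k : ℕ} :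
    ∀ (n : ℕ) (w : ω), lev w = n → w ∈ B k →
      ∑ u ∈ ancestors par w₀ w, (b u - b (par u)) = b w - b w₀ := by
  classical
  intro n
  induction n using Nat.strong_induction_on with
  | _ n ih =>
    intro w hn hw
    by_cases hne : w = w₀
    · subst hne
      simp [ancestors_root hroot]
    · obtain ⟨h1, h2⟩ := hpar k w hw hne
      rw [ancestors_eq_insert hne, Finset.sum_insert (not_mem_ancestors_parent hroot hpar hw hne),
        ih _ (hn ▸ h2) (par w) rfl h1]
      abel

end Ancestors

end Multigraph

/-! ### Relations among members of an independent family. -/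

section LinearRelations

variable {F M E ι : Type*} [Field F] [AddCommGroup M] [Module F M]

open Classical in
/-- If a combination with nonzero coefficients of members of an independent family vanishes, then
each member occurs in it at least twice. -/
theorem two_mul_card_image_le {v : E → M} {s : Finset ι} {f : ι → E} {a : ι → F}
    (ha : ∀ i ∈ s, a i ≠ 0) (hsum : ∑ i ∈ s, a i • v (f i) = 0)
    (hind : LinearIndepOn F v (s.image f : Finset E)) : 2 * (s.image f).card ≤ s.card := by
  rw [Finset.card_eq_sum_card_image f s, mul_comm, ← smul_eq_mul, ← Finset.sum_const]
  refine Finset.sum_le_sum fun e he => ?_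
  -- Collecting equal vectors, independence makes the coefficients over each fibre sum to zero; a
  -- one-element fibre would force a zero coefficient.
  have hcoef : ∀ e ∈ s.image f, ∑ i ∈ s.filter (fun i => f i = e), a i = 0 := by
    refine linearIndepOn_finset_iff.1 hind _ ?_
    rw [← hsum, ← Finset.sum_fiberwise_of_maps_to (fun i hi => Finset.mem_image_of_mem f hi)]
    refine Finset.sum_congr rfl fun e _ => ?_
    rw [Finset.sum_smul]
    exact Finset.sum_congr rfl fun i hi => by rw [(Finset.mem_filter.1 hi).2]
  by_contra! hlt
  obtain ⟨i, hi, rfl⟩ := Finset.mem_image.1 he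
  have hmem : i ∈ s.filter (fun j => f j = f i) := Finset.mem_filter.2 ⟨hi, rfl⟩
  have hcard : (s.filter (fun j => f j = f i)).card ≤ 1 := by omega
  have hsing : s.filter (fun j => f j = f i) = {i} := by
    refine Finset.eq_singleton_iff_unique_mem.2 ⟨hmem, fun j hj => ?_⟩
    exact Finset.card_le_one.1 hcard _ hj _ hmem
  have := hcoef _ he
  rw [hsing, Finset.sum_singleton] at this
  exact ha i hi this

end LinearRelations

/-! ### Growth of balls. -/

namespace Multigraph

variable {F M E ω ε : Type*} [Field F] [AddCommGroup M] [Module F M]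

open Classical in
/-- The projection of the paths from the root to the two ends of an edge, together with that edge,
is small when all small subfamilies are independent. -/
theorem card_projection_le {L m : ℕ} {v : E → M} {b : ω → M} {par : ω → ω} {r : ω → E}
    (hind : ∀ X : Finset E, X.card ≤ L → LinearIndepOn F v (X : Set E)) (hm : 2 * m ≤ L)
    {S T : Finset ω} {w₀ s t : ω} {e : E} {c : F} (hc : c ≠ 0) (he : b t - b s = c • v e)
    (hS : ∑ u ∈ S, (b u - b (par u)) = b s - b w₀) (hT : ∑ u ∈ T, (b u - b (par u)) = b t - b w₀)
    (hr : ∀ u ∈ S ∪ T, ∃ a : F, a ≠ 0 ∧ b u - b (par u) = a • v (r u))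
    (hcard : S.card + T.card + 1 ≤ 2 * m) :
    (insert e ((S ∪ T).image r)).card ≤ m := by
  choose! a ha hab using hr
  -- The common stem cancels; the symmetric difference together with `e`, represented by `none`, is
  -- the cycle.
  let C : Finset ω := (S \ T) ∪ (T \ S)
  let f : Option ω → E := fun o => o.elim e r
  let d : Option ω → F := fun o => o.elim c fun u => if u ∈ S then a u else -a u
  have hCsub : C ⊆ S ∪ T := by
    intro u hu
    simp only [C, Finset.mem_union, Finset.mem_sdiff] at hu ⊢
    tauto
  have hdisj : Disjoint (S \ T) (T \ S) := disjoint_sdiff_sdiff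
  have hsum : ∑ o ∈ Finset.insertNone C, d o • v (f o) = 0 := by
    rw [Finset.sum_insertNone, Finset.sum_union hdisj]
    have h1 : ∑ u ∈ S \ T, d (some u) • v (f (some u)) = ∑ u ∈ S \ T, (b u - b (par u)) := by
      refine Finset.sum_congr rfl fun u hu => ?_
      have hu' := Finset.mem_sdiff.1 hu
      rw [hab u (Finset.mem_union_left _ hu'.1)]
      simp [d, f, hu'.1]
    have h2 : ∑ u ∈ T \ S, d (some u) • v (f (some u)) = -∑ u ∈ T \ S, (b u - b (par u)) := by
      rw [← Finset.sum_neg_distrib]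
      refine Finset.sum_congr rfl fun u hu => ?_
      have hu' := Finset.mem_sdiff.1 hu
      rw [hab u (Finset.mem_union_right _ hu'.1)]
      simp [d, f, hu'.2]
    have h3 := Finset.sum_sdiff_sub_sum_sdiff (s₁ := T) (s₂ := S) (f := fun u => b u - b (par u))
    rw [h1, h2, show d none • v (f none) = b t - b s from he.symm]
    have h4 : ∑ u ∈ S \ T, (b u - b (par u)) - ∑ u ∈ T \ S, (b u - b (par u)) = b s - b t := by
      rw [h3, hS, hT]
      abel
    rw [← sub_eq_add_neg, h4]
    abel
  have hd : ∀ o ∈ Finset.insertNone C, d o ≠ 0 := by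
    intro o ho
    cases o with
    | none => exact hc
    | some u =>
      have hu := hCsub (Finset.some_mem_insertNone.1 ho)
      by_cases h : u ∈ S
      · simpa [d, h] using ha u hu
      · simpa [d, h] using ha u hu
  have hC : C.card + 2 * (S ∩ T).card = S.card + T.card := by
    have h1 := Finset.card_union_of_disjoint hdisj
    have h2 := Finset.card_sdiff_add_card_inter S T
    have h3 := Finset.card_sdiff_add_card_inter T S
    rw [Finset.inter_comm T S] at h3
    change C.card = _ at h1
    omega
  -- The cycle loses at least half its length in projection. The stem need not, but it is counted
  -- twice in `S.card + T.card`.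
  have hfib := two_mul_card_image_le (f := f) hd hsum (hind _ (by
    have := Finset.card_image_le (s := Finset.insertNone C) (f := f)
    rw [Finset.card_insertNone] at this
    omega))
  rw [Finset.card_insertNone] at hfib
  have hsub : insert e ((S ∪ T).image r) ⊆ (Finset.insertNone C).image f ∪ (S ∩ T).image r := by
    intro x hx
    rw [Finset.mem_union, Finset.mem_image, Finset.mem_image]
    rcases Finset.mem_insert.1 hx with rfl | hx
    · exact Or.inl ⟨none, Finset.none_mem_insertNone, rfl⟩
    · obtain ⟨u, hu, rfl⟩ := Finset.mem_image.1 hx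
      by_cases h : u ∈ S ∩ T
      · exact Or.inr ⟨u, h, rfl⟩
      · refine Or.inl ⟨some u, Finset.some_mem_insertNone.2 ?_, rfl⟩
        simp only [C, Finset.mem_union, Finset.mem_sdiff, Finset.mem_inter] at hu h ⊢
        tauto
  have h1 := Finset.card_le_card hsub
  have h2 := Finset.card_union_le ((Finset.insertNone C).image f) ((S ∩ T).image r)
  have h3 := Finset.card_image_le (s := S ∩ T) (f := r)
  omega

variable [Fintype ω]

/-- If all small subfamilies are independent, then the edges meeting a ball of small radius are at
most as many as the vertices of the next ball. -/
theorem card_incident_ball_le {src tgt : ε → ω} {L k : ℕ} {v : E → M} {b : ω → M} {π : ε → E}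
    {c : ε → F} (hc : ∀ g, c g ≠ 0) (hb : ∀ g, b (tgt g) - b (src g) = c g • v (π g))
    (hcov : ∀ X : Finset E, LinearIndepOn F v (X : Set E) → ∀ S : Finset ε, (∀ g ∈ S, π g ∈ X) →
      ∀ K : Finset ω, (∀ g ∈ S, src g ∈ K ∧ tgt g ∈ K) → S.card ≤ K.card)
    (hind : ∀ X : Finset E, X.card ≤ L → LinearIndepOn F v (X : Set E))
    (H : Finset ε) (w₀ : ω) (hk : 2 * (k + 1) ≤ L) :
    (incident src tgt H (ball src tgt H w₀ k)).card ≤ (ball src tgt H w₀ (k + 1)).card := by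
  classical
  by_contra! hlt
  have hne : Nonempty ε := by
    obtain ⟨g, -⟩ := Finset.card_pos.1 (lt_of_le_of_lt (Nat.zero_le _) hlt)
    exact ⟨g⟩
  obtain ⟨par, p, lev, hlev, hroot, hpar⟩ := exists_parent src tgt H w₀
  have hpar' : ∀ k, ∀ w ∈ ball src tgt H w₀ k, w ≠ w₀ →
      par w ∈ ball src tgt H w₀ k ∧ lev (par w) < lev w :=
    fun k w hw h => ⟨(hpar k w hw h).1, (hpar k w hw h).2.1⟩
  set B := ball src tgt H w₀ with hB
  set A := ancestors par w₀ with hA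
  have hanc : ∀ j, ∀ w ∈ B j, ∀ u ∈ A w, u ∈ B j :=
    fun j w hw u hu => (ancestors_subset_and_lev hroot hpar' _ w rfl hw u hu).1
  -- A tree edge determines its child, the end of larger level.
  have hinj : ∀ x ∈ B (k + 1), ∀ y ∈ B (k + 1), x ≠ w₀ → y ≠ w₀ → p x = p y → x = y := by
    intro x hx y hy hx0 hy0 hxy
    obtain ⟨-, h1, h2⟩ := hpar _ x hx hx0
    obtain ⟨-, h3, h4⟩ := hpar _ y hy hy0
    rw [hxy] at h2
    rcases h2 with ⟨h2, h2'⟩ | ⟨h2, h2'⟩ <;> rcases h4 with ⟨h4, h4'⟩ | ⟨h4, h4'⟩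
    · exact h2'.symm.trans h4'
    · rw [← h2, h4] at h1
      rw [← h4', h2'] at h3
      omega
    · rw [← h2', h4'] at h1
      rw [← h4, h2] at h3
      omega
    · exact h2.symm.trans h4
  let T : Finset ε := ((B (k + 1)).erase w₀).image p
  have hTcard : T.card + 1 ≤ (B (k + 1)).card := by
    have h1 := Finset.card_image_le (s := (B (k + 1)).erase w₀) (f := p)
    have h2 := Finset.card_erase_add_one (root_mem_ball src tgt H w₀ (k + 1))
    change T.card ≤ _ at h1
    rw [← hB] at h2
    omega
  -- The tree has at least one edge fewer than the ball has vertices, so the assumed excess leaves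
  -- two edges outside it.
  have htwo : 1 < (incident src tgt H (B k) \ T).card := by
    have := Finset.le_card_sdiff T (incident src tgt H (B k))
    omega
  obtain ⟨g₁, hg₁, g₂, hg₂, hg⟩ := Finset.one_lt_card.1 htwo
  have hAT : ∀ w ∈ B (k + 1), ∀ u ∈ A w, u ∈ (B (k + 1)).erase w₀ := fun w hw u hu =>
    Finset.mem_erase.2 ⟨(mem_ancestors.1 hu).1, hanc _ w hw u hu⟩
  have hcoef : ∀ w ∈ B (k + 1), ∀ u ∈ A w, ∃ a : F, a ≠ 0 ∧ b u - b (par u) = a • v (π (p u)) := by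
    intro w hw u hu
    obtain ⟨h1, h2⟩ := Finset.mem_erase.1 (hAT w hw u hu)
    rcases (hpar _ u h2 h1).2.2 with ⟨h3, h4⟩ | ⟨h3, h4⟩
    · refine ⟨c (p u), hc _, ?_⟩
      rw [← hb, h3, h4]
    · refine ⟨-c (p u), neg_ne_zero.2 (hc _), ?_⟩
      rw [neg_smul, ← hb, h3, h4, neg_sub]
  let N : ε → Finset ω := fun g => A (src g) ∪ A (tgt g)
  have hlol : ∀ g ∈ incident src tgt H (B k) \ T,
      (insert (π g) ((N g).image (π ∘ p))).card ≤ k + 1 := by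
    intro g hg
    have hgi := (Finset.mem_sdiff.1 hg).1
    obtain ⟨hs, ht⟩ := ends_mem_ball_succ hgi
    refine card_projection_le (b := b) (par := par) (w₀ := w₀) hind hk (hc g) (hb g)
      (sum_ancestors b hroot hpar' _ _ rfl hs) (sum_ancestors b hroot hpar' _ _ rfl ht) ?_ ?_
    · intro u hu
      rcases Finset.mem_union.1 hu with hu | hu
      · exact hcoef _ hs u hu
      · exact hcoef _ ht u hu
    -- One end of `g` lies in the smaller ball, so the paths have lengths at most `k` and `k + 1`;
    -- with `g` this makes `2 * (k + 1)`.
    · have h1 : (A (src g)).card ≤ _ := card_ancestors_le hroot hpar' _ _ rfl hs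
      have h2 : (A (tgt g)).card ≤ _ := card_ancestors_le hroot hpar' _ _ rfl ht
      have h3 := hlev _ _ hs
      have h4 := hlev _ _ ht
      rcases (mem_incident.1 hgi).2 with h | h
      · have := hlev _ _ h
        omega
      · have := hlev _ _ h
        omega
  have hNT : ∀ g ∈ incident src tgt H (B k) \ T, ∀ u ∈ N g, u ∈ (B (k + 1)).erase w₀ := by
    intro g hg u hu
    obtain ⟨hs, ht⟩ := ends_mem_ball_succ (Finset.mem_sdiff.1 hg).1
    rcases Finset.mem_union.1 hu with hu | hu
    · exact hAT _ hs u hu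
    · exact hAT _ ht u hu
  have hNpar : ∀ g, ∀ u ∈ N g, par u = w₀ ∨ par u ∈ N g := by
    intro g u hu
    refine or_iff_not_imp_left.2 fun h => ?_
    rcases Finset.mem_union.1 hu with hu | hu
    · exact Finset.mem_union_left _ (parent_mem_ancestors hu h)
    · exact Finset.mem_union_right _ (parent_mem_ancestors hu h)
  have hNend : ∀ g, (src g = w₀ ∨ src g ∈ N g) ∧ (tgt g = w₀ ∨ tgt g ∈ N g) := fun g =>
    ⟨or_iff_not_imp_left.2 fun h => Finset.mem_union_left _ (self_mem_ancestors h),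
      or_iff_not_imp_left.2 fun h => Finset.mem_union_right _ (self_mem_ancestors h)⟩
  let X : Finset E := insert (π g₁) ((N g₁).image (π ∘ p)) ∪ insert (π g₂) ((N g₂).image (π ∘ p))
  have hX : LinearIndepOn F v (X : Set E) := by
    apply hind
    have h1 := hlol g₁ hg₁
    have h2 := hlol g₂ hg₂
    have := Finset.card_union_le (insert (π g₁) ((N g₁).image (π ∘ p)))
      (insert (π g₂) ((N g₂).image (π ∘ p)))
    change X.card ≤ _ at this
    omega
  let Q : Finset ω := N g₁ ∪ N g₂
  have hQT : ∀ u ∈ Q, u ∈ (B (k + 1)).erase w₀ := by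
    intro u hu
    rcases Finset.mem_union.1 hu with hu | hu
    · exact hNT _ hg₁ u hu
    · exact hNT _ hg₂ u hu
  have hQp : (Q.image p).card = Q.card := by
    refine Finset.card_image_of_injOn fun x hx y hy hxy => ?_
    obtain ⟨hx0, hx⟩ := Finset.mem_erase.1 (hQT x hx)
    obtain ⟨hy0, hy⟩ := Finset.mem_erase.1 (hQT y hy)
    exact hinj x hx y hy hx0 hy0 hxy
  have hQsub : Q.image p ⊆ T := Finset.image_subset_image fun u hu => hQT u hu
  have hS : (insert g₁ (insert g₂ (Q.image p))).card = Q.card + 2 := by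
    rw [Finset.card_insert_of_notMem, Finset.card_insert_of_notMem, hQp]
    · exact fun h => (Finset.mem_sdiff.1 hg₂).2 (hQsub h)
    · intro h
      rcases Finset.mem_insert.1 h with h | h
      · exact hg h
      · exact (Finset.mem_sdiff.1 hg₁).2 (hQsub h)
  -- The two lollipops have `|Q| + 2` edges on at most `|Q| + 1` vertices, and their projection `X`
  -- is independent.
  have hfin := hcov X hX (insert g₁ (insert g₂ (Q.image p))) (by
      intro g hg
      simp only [Finset.mem_insert, Finset.mem_image] at hg
      simp only [X, Finset.mem_union, Finset.mem_insert, Finset.mem_image, Function.comp]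
      rcases hg with rfl | rfl | ⟨u, hu, rfl⟩
      · exact Or.inl (Or.inl rfl)
      · exact Or.inr (Or.inl rfl)
      · rcases Finset.mem_union.1 hu with hu | hu
        · exact Or.inl (Or.inr ⟨u, hu, rfl⟩)
        · exact Or.inr (Or.inr ⟨u, hu, rfl⟩)) (insert w₀ Q) (by
      have hmem : ∀ x, (x = w₀ ∨ x ∈ N g₁) ∨ (x = w₀ ∨ x ∈ N g₂) → x ∈ insert w₀ Q := by
        intro x hx
        simp only [Q, Finset.mem_insert, Finset.mem_union]
        tauto
      intro g hg
      simp only [Finset.mem_insert, Finset.mem_image] at hg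
      rcases hg with rfl | rfl | ⟨u, hu, rfl⟩
      · exact ⟨hmem _ (Or.inl (hNend _).1), hmem _ (Or.inl (hNend _).2)⟩
      · exact ⟨hmem _ (Or.inr (hNend _).1), hmem _ (Or.inr (hNend _).2)⟩
      · have hu1 : u ∈ insert w₀ Q := Finset.mem_insert_of_mem hu
        have hu2 : par u ∈ insert w₀ Q := by
          rcases Finset.mem_union.1 hu with hu | hu
          · exact hmem _ (Or.inl (hNpar _ u hu))
          · exact hmem _ (Or.inr (hNpar _ u hu))
        obtain ⟨h1, h2⟩ := Finset.mem_erase.1 (hQT u hu)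
        rcases (hpar _ u h2 h1).2.2 with ⟨h3, h4⟩ | ⟨h3, h4⟩
        · rw [h3, h4]; exact ⟨hu2, hu1⟩
        · rw [h3, h4]; exact ⟨hu1, hu2⟩)
  have := Finset.card_insert_le w₀ Q
  omega

/-- If all small subfamilies are independent, then the number of vertices is exponential in the
density. -/
theorem two_mul_pow_le_card [Fintype ε] [Nonempty ω] {src tgt : ε → ω} {L R : ℕ} {v : E → M}
    {b : ω → M} {π : ε → E} {c : ε → F} (hc : ∀ g, c g ≠ 0)
    (hb : ∀ g, b (tgt g) - b (src g) = c g • v (π g))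
    (hcov : ∀ X : Finset E, LinearIndepOn F v (X : Set E) → ∀ S : Finset ε, (∀ g ∈ S, π g ∈ X) →
      ∀ K : Finset ω, (∀ g ∈ S, src g ∈ K ∧ tgt g ∈ K) → S.card ≤ K.card)
    (hind : ∀ X : Finset E, X.card ≤ L → LinearIndepOn F v (X : Set E))
    {D : ℝ} (hD : 0 ≤ D) (hcard : D * Fintype.card ω ≤ Fintype.card ε) (hR : 1 ≤ R)
    (hRL : 2 * R ≤ L) : 2 * D ^ R ≤ Fintype.card ω := by
  classical
  obtain ⟨K, H, hK, hH, hHK, hexp⟩ := exists_dense_core src tgt D hcard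
  -- A loop would project to a zero vector, which is dependent by itself.
  have hloop : ∀ g ∈ H, src g ≠ tgt g := by
    intro g _ h
    have h1 := hb g
    rw [h, sub_self] at h1
    have h2 : v (π g) = 0 := ((smul_eq_zero.1 h1.symm).resolve_left (hc g))
    have h3 := hind {π g} (by rw [Finset.card_singleton]; omega)
    exact h3.ne_zero (by simp : π g ∈ (({π g} : Finset E) : Set E)) h2
  obtain ⟨w₀, hw₀, hdeg⟩ := exists_large_degree hK hH hHK hloop
  -- The degree of `w₀` supplies the initial factor `2 * D`; each later step gains `D` from the
  -- core.
  have hball : ∀ n, n + 1 ≤ R → 2 * D ^ (n + 1) ≤ (ball src tgt H w₀ (n + 1)).card := by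
    intro n
    induction n with
    | zero =>
      intro h
      have h1 := card_incident_ball_le (k := 0) hc hb hcov hind H w₀ (by omega)
      have h2 : ((incident src tgt H {w₀}).card : ℝ) ≤ (ball src tgt H w₀ (0 + 1)).card := by
        exact_mod_cast h1
      rw [zero_add, pow_one]
      exact hdeg.trans h2
    | succ n ih =>
      intro h
      have h1 := card_incident_ball_le (k := n + 1) hc hb hcov hind H w₀ (by omega)
      have h2 : ((incident src tgt H (ball src tgt H w₀ (n + 1))).card : ℝ)
          ≤ (ball src tgt H w₀ (n + 1 + 1)).card := by exact_mod_cast h1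
      have h3 := hexp _ (ball_subset hw₀ hH (n + 1))
      have h4 := mul_le_mul_of_nonneg_left (ih (by omega)) hD
      calc 2 * D ^ (n + 1 + 1) = D * (2 * D ^ (n + 1)) := by ring
        _ ≤ _ := h4.trans (h3.trans h2)
  obtain ⟨n, rfl⟩ : ∃ n, R = n + 1 := ⟨R - 1, by omega⟩
  refine (hball n le_rfl).trans ?_
  exact_mod_cast Finset.card_le_univ _

end Multigraph

/-! ### Frame matrices and their graph representations. -/

/-- Row rank equals column rank; from here on the matroid is handled through the columns. -/
theorem RepMatroid.rank_ofMatrix {F V E : Type*} [Field F] [Fintype V] [Fintype E]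
    (A : Matrix V E F) (X : Set E) :
    (RepMatroid.ofMatrix A).rank X =
      Module.finrank F (Submodule.span F (A.col '' X)) := by
  classical
  have h1 : (RepMatroid.ofMatrix A).rank X
      = (A.submatrix id (Subtype.val : X → E)).rank := by
    rw [Matrix.rank_eq_finrank_span_row, RepMatroid.rank, RepMatroid.ofMatrix,
      Submodule.map_span, ← Set.range_comp]
    rfl
  have h2 : A.col '' X = Set.range (A.submatrix id (Subtype.val : X → E)).col := by
    rw [Set.image_eq_range]
    rfl
  rw [h1, Matrix.rank_eq_finrank_span_cols, h2]

/-- A connected graph representing a frame matrix has at most one more vertex than the rank. -/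
theorem card_le_rank_add_one {F V E : Type*} [Field F] [Fintype V] [Fintype E]
    {G : LabelledDigraph Fˣ V E} (hG : G.IsConnected) {A : Matrix V E F} {c : E → F}
    (hc : ∀ e, c e ≠ 0) (hA : ∀ e (y : V → F),
      ∑ x, y x * A x e = c e * (y (G.head e) - G.label e * y (G.tail e))) :
    Fintype.card V ≤ (RepMatroid.ofMatrix A).rank Set.univ + 1 := by
  classical
  have hrank : (RepMatroid.ofMatrix A).rank Set.univ = A.transpose.rank := by
    rw [RepMatroid.rank_ofMatrix, Set.image_univ, Matrix.rank_transpose,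
      Matrix.rank_eq_finrank_span_cols]
  rw [hrank]
  have hker := LinearMap.finrank_range_add_finrank_ker A.transpose.mulVecLin
  rw [Module.finrank_fintype_fun_eq_card] at hker
  have hrk : A.transpose.rank = Module.finrank F (LinearMap.range A.transpose.mulVecLin) := rfl
  suffices h : Module.finrank F (LinearMap.ker A.transpose.mulVecLin) ≤ 1 by omega
  rcases isEmpty_or_nonempty V with hV | ⟨⟨v₀⟩⟩
  · rw [Fintype.card_eq_zero] at hker
    omega
  -- A vector in the left kernel satisfies `y (head e) = label e * y (tail e)`, so vanishing at `v₀`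
  -- spreads along walks and the kernel has dimension at most one.
  have hinj : Function.Injective
      ((LinearMap.proj v₀ : (V → F) →ₗ[F] F).comp (LinearMap.ker A.transpose.mulVecLin).subtype) := by
    rw [← LinearMap.ker_eq_bot, LinearMap.ker_eq_bot']
    rintro ⟨y, hy⟩ hy0
    have hy0 : y v₀ = 0 := hy0
    have hy' : ∀ e, y (G.head e) - G.label e * y (G.tail e) = 0 := by
      intro e
      have h1 : ∑ x, y x * A x e = 0 := by
        have := congrFun (LinearMap.mem_ker.1 hy) e
        simpa only [Matrix.mulVecLin_apply, Matrix.mulVec, dotProduct, Matrix.transpose_apply,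
          Pi.zero_apply, mul_comm] using this
      rw [hA] at h1
      exact (mul_eq_zero.1 h1).resolve_left (hc e)
    have hadj : ∀ e, y (G.head e) = 0 ↔ y (G.tail e) = 0 := by
      intro e
      have h := sub_eq_zero.1 (hy' e)
      rw [h]
      simp
    have hwalk : ∀ u w, (SimpleGraph.fromRel fun x y : V => ∃ e : E, G.tail e = x ∧ G.head e = y).Walk
        u w → y u = 0 → y w = 0 := by
      intro u w p hy0
      induction p with
      | nil => exact hy0
      | cons h _ ih =>
        apply ih
        rcases ((SimpleGraph.fromRel_adj _ _ _).1 h).2 with ⟨e, h1, h2⟩ | ⟨e, h1, h2⟩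
        · rw [← h2, hadj e, h1]; exact hy0
        · rw [← h1, ← hadj e, h2]; exact hy0
    ext w
    obtain ⟨p⟩ := hG v₀ w
    exact hwalk v₀ w p hy0
  simpa using LinearMap.finrank_le_finrank_of_injective hinj

/-- The columns of a frame matrix in terms of a graph representation. -/
theorem exists_column_scaling {F V E : Type*} [Field F] [Fintype V] [DecidableEq V]
    {G : LabelledDigraph Fˣ V E} {A : Matrix V E F} (hA : IsFrameMatrix A)
    (hGA : IsGraphRepresentation G A) :
    ∃ c : E → F, (∀ e, c e ≠ 0) ∧ ∀ e, A.col e =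
      c e • (Pi.single (G.head e) 1 - (G.label e : F) • Pi.single (G.tail e) 1) := by
  suffices h : ∀ e, ∃ c : F, c ≠ 0 ∧ A.col e =
      c • (Pi.single (G.head e) 1 - (G.label e : F) • Pi.single (G.tail e) 1) by
    choose c hc using h
    exact ⟨c, fun e => (hc e).1, fun e => (hc e).2⟩
  intro e
  by_cases h0 : ∀ x, A x e = 0
  · obtain ⟨h1, h2⟩ := hGA.zero e h0
    refine ⟨1, one_ne_zero, ?_⟩
    ext x
    simp [h1, h2, h0]
  push Not at h0
  obtain ⟨x, hx⟩ := h0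
  by_cases h1 : ∀ y, y ≠ x → A y e = 0
  · obtain ⟨ht, hh, hl⟩ := hGA.one e x hx h1
    have hl' : (1 : F) - G.label e ≠ 0 := by
      rw [sub_ne_zero]
      exact fun h => hl (Units.ext h.symm)
    -- At a loop the bracket collapses to `1 - label e` times a unit vector, nonzero because the
    -- label is not `1`.
    refine ⟨A x e / (1 - G.label e), div_ne_zero hx hl', ?_⟩
    ext z
    rw [ht, hh]
    by_cases hz : z = x
    · subst hz
      simp [hl']
    · simp [hz, h1 z hz]
  push Not at h1
  obtain ⟨y, hyx, hy⟩ := h1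
  have hrest : ∀ z, z ≠ x → z ≠ y → A z e = 0 := by
    intro z hzx hzy
    by_contra hz
    have hsub : ({x, y, z} : Set V) ⊆ {x : V | A x e ≠ 0} := by
      rintro w (rfl | rfl | rfl) <;> assumption
    have h3 : ({x, y, z} : Set V).encard = 3 :=
      Set.encard_eq_three.2 ⟨x, y, z, hyx.symm, hzx.symm, hzy.symm, rfl⟩
    have := (Set.encard_le_encard hsub).trans (hA e)
    rw [h3] at this
    exact absurd this (by decide)
  have aux : ∀ x y, x ≠ y → A x e ≠ 0 → A y e ≠ 0 → (∀ z, z ≠ x → z ≠ y → A z e = 0) →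
      G.tail e = x → G.head e = y → (G.label e : F) = -(A x e) * (A y e)⁻¹ →
      ∃ c : F, c ≠ 0 ∧ A.col e =
        c • (Pi.single (G.head e) 1 - (G.label e : F) • Pi.single (G.tail e) 1) := by
    intro x y hxy hx hy hz ht hh hl
    refine ⟨A y e, hy, ?_⟩
    ext z
    rw [ht, hh, hl]
    by_cases hzx : z = x
    · subst hzx
      simp [hxy]
      field_simp
    · by_cases hzy : z = y
      · subst hzy
        simp [hzx]
      · simp [hzx, hzy, hz z hzx hzy]
  rcases hGA.two e x y hyx.symm hx hy with ⟨h1, h2, h3⟩ | ⟨h1, h2, h3⟩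
  · exact aux x y hyx.symm hx hy hrest h1 h2 h3
  · exact aux y x hyx hy hx (fun z hz1 hz2 => hrest z hz2 hz1) h1 h2 h3

/-- An independent family of vectors, each supported on two coordinates, has a system of distinct
representatives among these coordinates. -/
theorem exists_injective_end {F V E : Type*} [Field F] [Finite V] [DecidableEq V]
    {v : E → V → F} {s t : E → V} (hv : ∀ e x, x ≠ s e → x ≠ t e → v e x = 0) {X : Finset E}
    (hX : LinearIndepOn F v (X : Set E)) :
    ∃ φ : E → V, Set.InjOn φ X ∧ ∀ e ∈ X, φ e = s e ∨ φ e = t e := by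
  classical
  -- Hall's condition: the independent vectors of `Y` lie in the span of the unit vectors indexed by
  -- `K`, so `|Y| ≤ |K|`.
  have hall := (Finset.all_card_le_biUnion_card_iff_exists_injective
    (fun e : X => ({s e, t e} : Finset V))).1 (by
      intro Y
      set K := Y.biUnion fun e : X => ({s e, t e} : Finset V) with hK
      have hli : LinearIndependent F (fun e : Y => v e.1) :=
        hX.comp (fun e : Y => e.1) Subtype.val_injective
      have hle : Submodule.span F (Set.range fun e : Y => v e.1)
          ≤ Submodule.span F (K.image fun k => (Pi.single k 1 : V → F) : Finset (V → F)) := by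
        rw [Submodule.span_le]
        rintro _ ⟨e, rfl⟩
        have hsum : v e.1 = ∑ k ∈ K, v e.1 k • (Pi.single k 1 : V → F) := by
          ext x
          rw [Finset.sum_apply]
          simp only [Pi.smul_apply, Pi.single_apply, smul_eq_mul, mul_ite, mul_one, mul_zero,
            Finset.sum_ite_eq]
          split_ifs with h
          · rfl
          · have hx : ∀ y ∈ ({s e.1.1, t e.1.1} : Finset V), x ≠ y := by
              rintro y hy rfl
              exact h (Finset.mem_biUnion.2 ⟨e.1, e.2, hy⟩)
            exact hv _ _ (hx _ (by simp)) (hx _ (by simp))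
        rw [SetLike.mem_coe]
        dsimp only
        rw [hsum]
        refine Submodule.sum_mem _ fun k hk => Submodule.smul_mem _ _ (Submodule.subset_span ?_)
        exact Finset.mem_coe.2 (Finset.mem_image_of_mem _ hk)
      have h1 := finrank_span_eq_card hli
      have h2 := Submodule.finrank_mono hle
      have h3 := finrank_span_finset_le_card (R := F) (K.image fun k => (Pi.single k 1 : V → F))
      have h4 := Finset.card_image_le (s := K) (f := fun k => (Pi.single k 1 : V → F))
      rw [Set.finrank] at h3
      rw [h1, Fintype.card_coe] at h2
      omega)
  obtain ⟨φ, hφ, hmem⟩ := hall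
  refine ⟨fun e => if h : e ∈ X then φ ⟨e, h⟩ else s e, ?_, ?_⟩
  · intro e he f hf hef
    have he' : e ∈ X := he
    have hf' : f ∈ X := hf
    simp only [dif_pos he', dif_pos hf'] at hef
    exact congrArg Subtype.val (hφ hef)
  · intro e he
    simp only [dif_pos he]
    simpa using hmem ⟨e, he⟩

/-! ### Small dependent sets from the covering graph, and their combination. -/

/-- A dense gain graph has a small dependent set of columns. -/
theorem exists_small_dependent {F V E : Type*} [Field F] [Fintype F] [Fintype V] [Fintype E]
    [DecidableEq V] {s t : E → V} {σ : E → Fˣ} {c : E → F} {v : E → V → F} (hc : ∀ e, c e ≠ 0)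
    (hv : ∀ e, v e = c e • (Pi.single (t e) 1 - (σ e : F) • Pi.single (s e) 1)) [Nonempty V]
    {D : ℝ} (hD : 0 ≤ D) (hcard : D * Fintype.card V ≤ Fintype.card E) {L R : ℕ} (hR : 1 ≤ R)
    (hRL : 2 * R ≤ L) (hlt : (Fintype.card V * (Fintype.card F - 1) : ℝ) < 2 * D ^ R) :
    ∃ X : Finset E, X.card ≤ L ∧ ¬ LinearIndepOn F v (X : Set E) := by
  classical
  by_contra! hind
  have hsupp : ∀ e x, x ≠ s e → x ≠ t e → v e x = 0 := by
    intro e x h1 h2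
    simp [hv, h1, h2]
  have := Multigraph.two_mul_pow_le_card (ω := V × Fˣ) (ε := E × Fˣ)
    (src := fun g => (s g.1, σ g.1 * g.2)) (tgt := fun g => (t g.1, g.2)) (v := v)
    (b := fun w => Pi.single w.1 (w.2 : F)) (π := Prod.fst)
    (c := fun g => (g.2 : F) * (c g.1)⁻¹) (L := L) (R := R) (D := D)
    (fun g => mul_ne_zero g.2.ne_zero (inv_ne_zero (hc _))) (by
      intro g
      ext x
      have := hc g.1
      simp only [hv, Pi.sub_apply, Pi.smul_apply, Pi.single_apply, smul_eq_mul, Units.val_mul]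
      split_ifs <;> field_simp <;> ring) (by
      intro X hX S hS K hK
      -- Send each edge `(e, γ)` to its end over `φ e`. This is injective: the first coordinate
      -- recovers `e`, and then the second recovers `γ`.
      obtain ⟨φ, hφ, hend⟩ := exists_injective_end hsupp hX
      refine Finset.card_le_card_of_injOn
        (fun g => if φ g.1 = s g.1 then (s g.1, σ g.1 * g.2) else (t g.1, g.2)) ?_ ?_
      · intro g hg
        have := hK g hg
        dsimp only
        split_ifs
        · exact this.1
        · exact this.2
      · have hfst : ∀ g ∈ S, (if φ g.1 = s g.1 then (s g.1, σ g.1 * g.2) else (t g.1, g.2)).1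
            = φ g.1 := by
          intro g hg
          split_ifs with h
          · exact h.symm
          · exact ((hend _ (hS g hg)).resolve_left h).symm
        intro g hg g' hg' h
        have h1 : φ g.1 = φ g'.1 := by
          rw [← hfst g hg, ← hfst g' hg']
          exact congrArg Prod.fst h
        have h2 := hφ (hS g hg) (hS g' hg') h1
        obtain ⟨e, γ⟩ := g
        obtain ⟨e', γ'⟩ := g'
        obtain rfl : e = e' := h2
        dsimp only at h
        split_ifs at h
        · simpa using h
        · simpa using h) hind hD (by
      simp only [Fintype.card_prod, Nat.cast_mul]
      rw [← mul_assoc]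
      exact mul_le_mul_of_nonneg_right hcard (Nat.cast_nonneg _)) hR hRL
  have hF : (Fintype.card F : ℝ) = Fintype.card Fˣ + 1 := by
    exact_mod_cast Fintype.card_eq_card_units_add_one (α := F)
  rw [hF, add_sub_cancel_right] at hlt
  simp only [Fintype.card_prod, Nat.cast_mul] at this
  linarith

/-- Small dependent sets avoiding any few elements can be combined to a set of given nullity. -/
theorem exists_large_nullity {F M E : Type*} [Field F] [AddCommGroup M] [Module F M]
    {v : E → M} {L t : ℕ}
    (h : ∀ Z : Finset E, Z.card < t → ∃ C : Finset E, Disjoint C Z ∧ C.card ≤ L ∧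
      ¬ LinearIndepOn F v (C : Set E)) :
    ∃ X : Finset E, X.card ≤ t * L ∧
      Module.finrank F (Submodule.span F (v '' X)) + t ≤ X.card := by
  classical
  -- `Z` collects redundant elements of `X`, one from each dependent set; each new set avoids the
  -- current `Z`, so its redundant element is new.
  have key : ∀ n ≤ t, ∃ Z X : Finset E, Z.card = n ∧ Z ⊆ X ∧ X.card ≤ n * L ∧
      ∀ z ∈ Z, v z ∈ Submodule.span F (v '' ((X \ Z : Finset E) : Set E)) := by
    intro n
    induction n with
    | zero => intro _; exact ⟨∅, ∅, rfl, subset_rfl, by simp, by simp⟩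
    | succ n ih =>
      intro hn
      obtain ⟨Z, X, hZ, hZX, hX, hspan⟩ := ih (by omega)
      obtain ⟨C, hCZ, hC, hdep⟩ := h Z (by omega)
      rw [linearIndepOn_iff_notMem_span] at hdep
      push Not at hdep
      obtain ⟨e, he, hes⟩ := hdep
      have heZ : e ∉ Z := Finset.disjoint_left.1 hCZ he
      have he' : v e ∈ Submodule.span F
          (v '' (((X ∪ C) \ insert e Z : Finset E) : Set E)) := by
        refine Submodule.span_mono (Set.image_mono ?_) hes
        rintro x ⟨hx, hxe⟩
        have hxZ : x ∉ Z := Finset.disjoint_left.1 hCZ hx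
        have hxC : x ∈ C := hx
        have hxe : x ≠ e := hxe
        simp [hxZ, hxC, hxe]
      refine ⟨insert e Z, X ∪ C, by rw [Finset.card_insert_of_notMem heZ, hZ], ?_, ?_, ?_⟩
      · exact Finset.insert_subset (Finset.mem_union_right _ he)
          (hZX.trans Finset.subset_union_left)
      · have := Finset.card_union_le X C
        rw [add_mul, one_mul]
        omega
      · intro z hz
        rcases Finset.mem_insert.1 hz with rfl | hz
        · exact he'
        -- The old generators may include `e`, but `v e` is itself spanned by the remaining ones.
        · refine Submodule.span_le.2 ?_ (hspan z hz)
          rintro _ ⟨x, hx, rfl⟩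
          by_cases hxe : x = e
          · rw [hxe]; exact he'
          · refine Submodule.subset_span ⟨x, ?_, rfl⟩
            have hx' := Finset.mem_sdiff.1 (Finset.mem_coe.1 hx)
            simp [hx'.1, hx'.2, hxe]
  obtain ⟨Z, X, hZ, hZX, hX, hspan⟩ := key t le_rfl
  refine ⟨X, hX, ?_⟩
  have hle : Submodule.span F (v '' X)
      ≤ Submodule.span F (((X \ Z).image v : Finset M) : Set M) := by
    rw [Submodule.span_le]
    rintro _ ⟨x, hx, rfl⟩
    rw [Finset.coe_image]
    by_cases hxZ : x ∈ Z
    · exact hspan x hxZ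
    · exact Submodule.subset_span ⟨x, by simpa [hxZ] using hx, rfl⟩
  have h1 := Submodule.finrank_mono hle
  have h2 := finrank_span_finset_le_card (R := F) ((X \ Z).image v)
  rw [Set.finrank] at h2
  have h3 := Finset.card_image_le (s := X \ Z) (f := v)
  have h4 := Finset.card_sdiff_add_card_eq_card hZX
  omega

/-! ### Numerical estimates. -/

theorem Real.pow_le_pow_of_mul_log_le {x y : ℝ} {m n : ℕ} (hx : 0 < x) (hy : 0 < y)
    (h : n * Real.log x ≤ m * Real.log y) : x ^ n ≤ y ^ m := by
  rw [← Real.log_le_log_iff (pow_pos hx n) (pow_pos hy m), Real.log_pow, Real.log_pow]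
  exact h

/-- A comparison of exponential growth at rate `1 + 3 q β / 4` with `q r`. -/
theorem mul_le_two_mul_pow_floor {q : ℕ} {r β : ℝ} (hq : 2 ≤ q) (hr : 7 < r) (hqr : q ≤ r)
    (hβ : 0 < β) (hβr : 1 + β ≤ r ^ 2) :
    1 ≤ ⌊2 * Real.log r / Real.log (1 + β)⌋₊ ∧
      q * r ≤ 2 * (1 + 3 / 4 * q * β) ^ ⌊2 * Real.log r / Real.log (1 + β)⌋₊ := by
  set R := ⌊2 * Real.log r / Real.log (1 + β)⌋₊ with hR
  have hlog : 0 < Real.log (1 + β) := Real.log_pos (by linarith)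
  have hlr : 0 < Real.log r := Real.log_pos (by linarith)
  have hq' : (2 : ℝ) ≤ q := by exact_mod_cast hq
  have hR1 : 1 ≤ R := by
    rw [hR, Nat.one_le_floor_iff, le_div_iff₀ hlog, one_mul]
    have := Real.log_le_log (by linarith) hβr
    rw [Real.log_pow] at this
    exact_mod_cast this
  have hfl : 2 * Real.log r < (R + 1) * Real.log (1 + β) := by
    rw [← div_lt_iff₀ hlog]
    exact Nat.lt_floor_add_one _
  refine ⟨hR1, ?_⟩
  have hD1 : 1 + β ≤ 1 + 3 / 4 * q * β := by nlinarith
  -- For such large `β` a single factor is enough; otherwise the exponent is at least `2`.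
  rcases lt_or_ge r (1 + β) with hβ1 | hβ1
  · have h1 : 1 + 3 / 4 * q * β ≤ (1 + 3 / 4 * q * β) ^ R :=
      le_self_pow₀ (by linarith) (by omega)
    have h2 : (q : ℝ) * (r - 1) ≤ q * β := mul_le_mul_of_nonneg_left (by linarith) (by linarith)
    nlinarith
  have hR2 : 2 ≤ R := by
    rw [hR]
    refine Nat.le_floor ?_
    rw [le_div_iff₀ hlog]
    push_cast
    exact mul_le_mul_of_nonneg_left (Real.log_le_log (by linarith) hβ1) (by norm_num)
  have hR2' : (2 : ℝ) ≤ R := by exact_mod_cast hR2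
  -- Here `R + 1 ≤ 3 * R / 2`, so rounding down still leaves `(1 + β) ^ R ≥ r ^ (4 / 3)`.
  have h34 : 4 * Real.log r ≤ 3 * R * Real.log (1 + β) := by nlinarith
  have hr1 : r ≤ (1 + β) ^ R := by
    have := Real.pow_le_pow_of_mul_log_le (x := r) (y := 1 + β) (n := 1) (m := R)
      (by linarith) (by linarith) (by push_cast; nlinarith)
    simpa using this
  rcases eq_or_lt_of_le hq with rfl | hq3
  · have := pow_le_pow_left₀ (by linarith) hD1 R
    push_cast at this ⊢
    linarith
  have hq3' : (3 : ℝ) ≤ q := by exact_mod_cast hq3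
  -- For `β ≤ 2` the rate is at least `(1 + β) ^ (3 / 2)`, giving `r ^ 2 ≥ q * r`. For `β > 2` it is
  -- at least `(q / 2) * (1 + β)`, and the squared factor `q / 2` supplies the missing `q`.
  rcases le_or_gt β 2 with hβ2 | hβ2
  · have h1 : (1 + β) ^ 3 ≤ (1 + 3 / 4 * q * β) ^ 2 := by
      have h3 : 1 + 9 / 4 * β ≤ 1 + 3 / 4 * q * β := by nlinarith
      have h4 : (1 + β) ^ 3 ≤ (1 + 9 / 4 * β) ^ 2 := by
        have h5 : 0 ≤ β ^ 2 * (2 - β) := mul_nonneg (sq_nonneg β) (by linarith)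
        nlinarith [sq_nonneg β]
      exact h4.trans (pow_le_pow_left₀ (by positivity) h3 2)
    have h2 : r ^ 4 ≤ (1 + β) ^ (3 * R) :=
      Real.pow_le_pow_of_mul_log_le (by linarith) (by linarith) (by push_cast; linarith)
    have h3 : (r ^ 2) ^ 2 ≤ ((1 + 3 / 4 * q * β) ^ R) ^ 2 := by
      calc (r ^ 2) ^ 2 = r ^ 4 := by ring
        _ ≤ ((1 + β) ^ 3) ^ R := by rw [← pow_mul]; exact h2
        _ ≤ ((1 + 3 / 4 * q * β) ^ 2) ^ R := pow_le_pow_left₀ (by positivity) h1 R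
        _ = _ := by rw [← pow_mul, ← pow_mul, mul_comm 2 R]
    have h4 : r ^ 2 ≤ (1 + 3 / 4 * q * β) ^ R := le_of_sq_le_sq h3 (by positivity)
    nlinarith
  · have h1 : (q / 2 : ℝ) * (1 + β) ≤ 1 + 3 / 4 * q * β := by nlinarith
    have h2 : (q / 2 : ℝ) ^ 2 ≤ (q / 2 : ℝ) ^ R := pow_le_pow_right₀ (by linarith) hR2
    have h3 : 0 ≤ ((q : ℝ) - 2) * (q * r) := mul_nonneg (by linarith) (by nlinarith)
    calc (q : ℝ) * r ≤ 2 * ((q / 2 : ℝ) ^ 2 * r) := by linarith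
      _ ≤ 2 * ((q / 2 : ℝ) ^ R * (1 + β) ^ R) := by gcongr
      _ = 2 * ((q / 2 : ℝ) * (1 + β)) ^ R := by rw [mul_pow]
      _ ≤ _ := by gcongr

theorem Real.seven_lt_exp_two : (7 : ℝ) < Real.exp 2 := by
  have h : Real.exp 2 = Real.exp 1 ^ 2 := by
    rw [← Real.exp_nat_mul]
    norm_num
  rw [h]
  nlinarith [Real.exp_one_gt_d9]

/-- The lower bounds on the rank leave room for the deletion of `t` elements. -/
theorem density_slack {q r β t : ℝ} (hq : 2 ≤ q) (hr : 7 < r) (hβ : 0 < β)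
    (h1 : (4 * t / (β * Real.log (1 + β))) ^ 2 ≤ (q - 1) * r)
    (h2 : (1 + β) * Real.exp 4 ≤ (q - 1) * r) :
    3 / 4 * q * β + t ≤ 1 / 4 * q * β * r := by
  have hlog : 0 < Real.log (1 + β) := Real.log_pos (by linarith)
  have hN : 0 < (q - 1) * r := by nlinarith
  set s := √((q - 1) * r) with hs
  have hs0 : 0 < s := Real.sqrt_pos.2 hN
  have hs2 : s ^ 2 = (q - 1) * r := Real.sq_sqrt hN.le
  have h3 : 4 * t ≤ s * (β * Real.log (1 + β)) := by
    rw [← div_le_iff₀ (by positivity)]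
    exact Real.le_sqrt_of_sq_le h1
  have h4 : Real.log (1 + β) + 4 ≤ 2 * Real.log s := by
    have := Real.log_le_log (by positivity) h2
    rw [Real.log_mul (by linarith) (Real.exp_ne_zero _), Real.log_exp, ← hs2, Real.log_pow] at this
    exact_mod_cast this
  -- The tangent to the logarithm at `e ^ 2`, chosen to absorb the `4` in `h4`.
  have h5 : Real.log s - 2 ≤ s / Real.exp 2 - 1 := by
    have := Real.log_le_sub_one_of_pos (div_pos hs0 (Real.exp_pos 2))
    rwa [Real.log_div hs0.ne' (Real.exp_ne_zero _), Real.log_exp] at this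
  have h6 : s / Real.exp 2 ≤ s / 7 :=
    div_le_div_of_nonneg_left hs0.le (by norm_num) Real.seven_lt_exp_two.le
  have h7 : Real.log (1 + β) ≤ 2 / 7 * s := by linarith
  have h8 : 4 * t ≤ 2 / 7 * β * ((q - 1) * r) := by
    rw [← hs2]
    calc 4 * t ≤ s * (β * Real.log (1 + β)) := h3
      _ ≤ s * (β * (2 / 7 * s)) := by gcongr
      _ = _ := by ring
  have h9 : 0 < q * β := by positivity
  -- By `h8`, `t` is at most `2/28` of `q * β * r`; since `r > 7`, the other term is at most `3/28`,
  -- and `7/28` is available.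
  nlinarith [mul_pos h9 (sub_pos.2 hr), mul_pos hβ (by linarith : 0 < r)]

/-! ### The main theorem. -/

theorem mainTheorem6 {F : Type*} [Field F] [Fintype F] {V E : Type*} [Fintype V] [Fintype E]
    (q : ℕ) (hq : Fintype.card F = q) (β : ℝ) (hβ : 0 < β) (t : ℕ) (ht : 1 ≤ t)
    (M : RepMatroid F E) (G : LabelledDigraph Fˣ V E)
    (hGM : IsGraphRepresentationOf G M) (hG : G.IsConnected)
    (hr : max (q : ℝ) (max ((2 * (q : ℝ) - 3) * β⁻¹ + 1 - (q : ℝ))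
        (max (1 / ((q : ℝ) - 1) * (4 * (t : ℝ) / (β * Real.log (1 + β))) ^ 2)
          ((1 + β) / ((q : ℝ) - 1) * Real.exp 4))) ≤ (M.rank Set.univ : ℝ))
    (hcard : (1 + (q : ℝ) * β) * (M.rank Set.univ : ℝ) ≤ (Fintype.card E : ℝ)) :
    ∃ X : Finset E, (M.rank (X : Set E) : ℤ) ≤ (X.card : ℤ) - (t : ℤ) ∧
      (X.card : ℝ) ≤ 4 * (t : ℝ) * Real.log (M.rank Set.univ : ℝ) / Real.log (1 + β) := by
  classical
  obtain ⟨A, hA, rfl, hGA⟩ := hGM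
  obtain ⟨c, hc, hcol⟩ := exists_column_scaling hA hGA
  have hV : Fintype.card V ≤ (RepMatroid.ofMatrix A).rank Set.univ + 1 := by
    refine card_le_rank_add_one hG hc fun e y => ?_
    have h1 : ∀ x, A x e = c e * ((Pi.single (G.head e) 1 : V → F) x
        - G.label e * (Pi.single (G.tail e) 1 : V → F) x) := fun x => congrFun (hcol e) x
    simp_rw [h1, mul_left_comm _ (c e), ← Finset.mul_sum, mul_sub, Finset.sum_sub_distrib,
      Pi.single_apply]
    simp
    ring
  have hrV : (RepMatroid.ofMatrix A).rank Set.univ ≤ Fintype.card V := by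
    rw [RepMatroid.rank_ofMatrix]
    exact (Submodule.finrank_le _).trans (Module.finrank_fintype_fun_eq_card F).le
  set r := (RepMatroid.ofMatrix A).rank Set.univ with hr_def
  have hq2 : 2 ≤ q := by
    have := Fintype.one_lt_card (α := F)
    omega
  have hq2' : (2 : ℝ) ≤ q := by exact_mod_cast hq2
  have hq1 : (0 : ℝ) < q - 1 := by linarith
  simp only [max_le_iff] at hr
  obtain ⟨hqr, -, hr3, hr4⟩ := hr
  rw [one_div, inv_mul_le_iff₀ hq1] at hr3
  rw [div_mul_eq_mul_div, div_le_iff₀ hq1, mul_comm (r : ℝ)] at hr4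
  have hexp : Real.exp 4 = Real.exp 2 ^ 2 := by
    rw [← Real.exp_nat_mul]
    norm_num
  have hr0 : (0 : ℝ) ≤ r := Nat.cast_nonneg _
  have hqrr : ((q : ℝ) - 1) * r ≤ r ^ 2 := by nlinarith
  have hr7 : (7 : ℝ) < r := by
    have h1 : Real.exp 2 ^ 2 ≤ (r : ℝ) ^ 2 := by
      rw [← hexp]
      nlinarith [Real.exp_pos 4]
    exact Real.seven_lt_exp_two.trans_le (le_of_sq_le_sq h1 hr0)
  have hβr : 1 + β ≤ (r : ℝ) ^ 2 := by
    have : (1 : ℝ) ≤ Real.exp 4 := Real.one_le_exp (by norm_num)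
    nlinarith
  obtain ⟨hR1, hgrow⟩ := mul_le_two_mul_pow_floor hq2 hr7 hqr hβ hβr
  have hslack := density_slack hq2' hr7 hβ hr3 hr4
  have hlog : 0 < Real.log (1 + β) := Real.log_pos (by linarith)
  have hlr : 0 < Real.log r := Real.log_pos (by linarith)
  have hVr : (Fintype.card V : ℝ) ≤ r + 1 := by exact_mod_cast hV
  have : Nonempty V := by
    rw [← Fintype.card_pos_iff]
    have : 0 < r := by exact_mod_cast (by linarith : (0 : ℝ) < r)
    omega
  -- `R` is the radius to which balls are grown, and `L` bounds the dependent sets: two lollipops of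
  -- at most `R` columns each.
  set R := ⌊2 * Real.log r / Real.log (1 + β)⌋₊ with hR
  set L := ⌊4 * Real.log r / Real.log (1 + β)⌋₊ with hL
  have hRL : 2 * R ≤ L := by
    refine Nat.le_floor ?_
    have := Nat.floor_le (a := 2 * Real.log r / Real.log (1 + β)) (by positivity)
    push_cast
    calc (2 : ℝ) * R ≤ 2 * (2 * Real.log r / Real.log (1 + β)) := by gcongr
      _ = _ := by ring
  obtain ⟨X, hX, hnull⟩ := exists_large_nullity (F := F) (v := A.col) (L := L) (t := t) (by
    intro Z hZ
    have hEZ : (Fintype.card {e // e ∉ Z} : ℝ) = Fintype.card E - Z.card := by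
      rw [Fintype.card_subtype_compl, Nat.cast_sub (Fintype.card_subtype_le _), Fintype.card_coe]
    -- A quarter of the excess `q * β * r` pays for the deleted `Z` and the possible extra vertex,
    -- leaving density `1 + 3 / 4 * q * β`. The cover has at most `(r + 1) * (q - 1)` vertices,
    -- below `q * r` because `q ≤ r`.
    obtain ⟨C, hC, hdep⟩ := exists_small_dependent (E := {e // e ∉ Z}) (s := fun e => G.tail e)
      (t := fun e => G.head e) (σ := fun e => G.label e) (c := fun e => c e)
      (v := fun e => A.col e) (fun e => hc e) (fun e => hcol e) (D := 1 + 3 / 4 * q * β)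
      (by positivity) (by
        rw [hEZ]
        have hZ' : (Z.card : ℝ) + 1 ≤ t := by exact_mod_cast hZ
        have := mul_le_mul_of_nonneg_left hVr (by positivity : 0 ≤ 1 + 3 / 4 * q * β)
        nlinarith) hR1 hRL (by
        rw [hq]
        have := mul_le_mul_of_nonneg_right hVr hq1.le
        nlinarith)
    refine ⟨C.map (Function.Embedding.subtype _), ?_, by rwa [Finset.card_map], fun h => hdep ?_⟩
    · rw [Finset.disjoint_left]
      intro e he
      obtain ⟨e', -, rfl⟩ := Finset.mem_map.1 he
      exact e'.2
    · rw [Finset.coe_map] at h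
      exact h.comp_of_image Subtype.val_injective.injOn)
  refine ⟨X, ?_, ?_⟩
  · rw [RepMatroid.rank_ofMatrix]
    omega
  · have hLle : (L : ℝ) ≤ 4 * Real.log r / Real.log (1 + β) := Nat.floor_le (by positivity)
    calc (X.card : ℝ) ≤ t * L := by exact_mod_cast hX
      _ ≤ t * (4 * Real.log r / Real.log (1 + β)) := by gcongr
      _ = _ := by ring
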